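/- Let $n\ge 0$. Regard $\mathbb{CP}^n$ as a smooth real manifold, and identify $\mathbb{C}^{(n+1)^2}$, with coordinates $w=(w_{ij})_{0\le i,j\le n}$, with $\mathbb{R}^{2(n+1)^2}$ through real and imaginary parts. A subset of $\mathbb{R}^m$ is called real algebraic if it is the common zero set of finitely many real polynomials. A real algebraic set $S\subset\mathbb{R}^m$ is called smooth of dimension $d$ if near each of its points $x$ it is the common zero set of $m-d$ real polynomials that vanish on $S$ and have linearly independent gradients at $x$. A subset of $\mathbb{CP}^n$ is called complex algebraic if it is the common zero set of a family of homogeneous polynomials in $\mathbb{C}[z_0,\dots,z_n]$. Then the well-defined map $$h:\mathbb{CP}^n\to\mathbb{C}^{(n+1)^2}\cong\mathbb{R}^{2(n+1)^2},\qquad h([z_0,\dots,z_n])=\Big(\frac{z_i\bar z_j}{\sum_{l=0}^n z_l\bar z_l}\Big)_{0\le i,j\le n},$$ has the following properties. 1. $h$ is a smooth embedding of real manifolds, that is, a $C^\infty$ immersion and a homeomorphism onto its image. 2. The image $h(\mathbb{CP}^n)$ is the set of all $w=(w_{ij})\in\mathbb{C}^{(n+1)^2}$ that satisfy $w_{ij}w_{kl}=w_{il}w_{kj}$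 for all $0\le i,j,k,l\le n$, $\sum_{i=0}^n w_{ii}=1$, and $w_{ij}=\overline{w_{ji}}$ for all $0\le i,j\le n$. 3. The image $h(\mathbb{CP}^n)$ is a smooth real algebraic subset of $\mathbb{R}^{2(n+1)^2}$, of dimension $2n$. 4. For every complex algebraic subset $B\subset\mathbb{CP}^n$, the image $h(B)$ is a real algebraic subset of $\mathbb{R}^{2(n+1)^2}$. -/

import Mathlib

open scoped Manifold ContDiff LinearAlgebra.Projectivization ComplexConjugate

/-! ### Complex projective space as a real smooth manifold -/

/-- Complex projective space `ℂℙⁿ`: lines in `ℂⁿ⁺¹`. -/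
abbrev CP (n : ℕ) : Type := ℙ ℂ (Fin (n + 1) → ℂ)

namespace CP

variable {n : ℕ}

/-- The quotient topology, from `ℂⁿ⁺¹ ∖ {0}`. -/
noncomputable instance instTopologicalSpace (n : ℕ) : TopologicalSpace (CP n) :=
  TopologicalSpace.coinduced (Projectivization.mk' (V := Fin (n + 1) → ℂ) ℂ) inferInstance

theorem isQuotientMap_mk (n : ℕ) :
    Topology.IsQuotientMap (Projectivization.mk' (V := Fin (n + 1) → ℂ) ℂ) :=
  ⟨⟨rfl⟩, fun x => ⟨⟨x.rep, x.rep_nonzero⟩, x.mk_rep⟩⟩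

/-- The affine piece `U_k = {[z] | z_k ≠ 0}`. -/
def affinePiece (k : Fin (n + 1)) : Set (CP n) :=
  {x | Projectivization.lift (fun v : {v : Fin (n + 1) → ℂ // v ≠ 0} => v.1 k ≠ 0)
    (by
      rintro ⟨a, ha⟩ ⟨b, hb⟩ t (rfl : a = t • b)
      have ht : t ≠ 0 := fun h => ha (by simp [h])
      simp [ht]) x}

@[simp] theorem mk_mem_affinePiece (k : Fin (n + 1)) (v : Fin (n + 1) → ℂ) (hv : v ≠ 0) :
    Projectivization.mk ℂ v hv ∈ affinePiece k ↔ v k ≠ 0 := Iff.rfl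

/-- The affine coordinates `[z] ↦ (z_j / z_k)_{j ≠ k}` on `U_k`. -/
noncomputable def affineCoord (k : Fin (n + 1)) : CP n → (Fin n → ℂ) :=
  Projectivization.lift
    (fun v : {v : Fin (n + 1) → ℂ // v ≠ 0} => fun j => v.1 (k.succAbove j) / v.1 k)
    (by
      rintro ⟨a, ha⟩ ⟨b, hb⟩ t (rfl : a = t • b)
      have ht : t ≠ 0 := fun h => ha (by simp [h])
      funext j
      simp [mul_div_mul_left _ _ ht])

@[simp] theorem affineCoord_mk (k : Fin (n + 1)) (v : Fin (n + 1) → ℂ) (hv : v ≠ 0) :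
    affineCoord k (Projectivization.mk ℂ v hv) = fun j => v (k.succAbove j) / v k := rfl

theorem insertNth_ne_zero (k : Fin (n + 1)) (u : Fin n → ℂ) :
    (k.insertNth (1 : ℂ) u : Fin (n + 1) → ℂ) ≠ 0 := fun h => by
  simpa using congrFun h k

/-- The inverse of the affine coordinates: put `1` in position `k`. -/
noncomputable def affineInv (k : Fin (n + 1)) (u : Fin n → ℂ) : CP n :=
  Projectivization.mk ℂ (k.insertNth (1 : ℂ) u) (insertNth_ne_zero k u)

theorem isOpen_affinePiece (k : Fin (n + 1)) : IsOpen (affinePiece (n := n) k) := by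
  rw [← (isQuotientMap_mk n).isOpen_preimage]
  exact isOpen_ne_fun ((continuous_apply k).comp continuous_subtype_val) continuous_const

theorem continuous_insertNth (k : Fin (n + 1)) :
    Continuous fun u : Fin n → ℂ => (k.insertNth (1 : ℂ) u : Fin (n + 1) → ℂ) :=
  continuous_const.finInsertNth k continuous_id

theorem continuous_affineInv (k : Fin (n + 1)) : Continuous (affineInv (n := n) k) :=
  (isQuotientMap_mk n).continuous.comp
    (Continuous.subtype_mk (continuous_insertNth k) (insertNth_ne_zero k))

/-- The standard affine chart on `U_k`. -/
noncomputable def affineChart (k : Fin (n + 1)) : OpenPartialHomeomorph (CP n) (Fin n → ℂ) where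
  toFun := affineCoord k
  invFun := affineInv k
  source := affinePiece k
  target := Set.univ
  map_source' _ _ := Set.mem_univ _
  map_target' u _ := by
    simp [affineInv]
  left_inv' x hx := by
    induction x using Projectivization.ind with
    | h v hv =>
      have hk : v k ≠ 0 := hx
      rw [affineInv, Projectivization.mk_eq_mk_iff']
      refine ⟨(v k)⁻¹, ?_⟩
      funext i
      refine Fin.succAboveCases k ?_ (fun j => ?_) i
      · simp [hk]
      · simp [div_eq_inv_mul]
  right_inv' u _ := by
    funext j
    simp [affineInv]
  open_source := isOpen_affinePiece k
  open_target := isOpen_univ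
  continuousOn_toFun := by
    rw [(isQuotientMap_mk n).continuousOn_isOpen_iff (isOpen_affinePiece k)]
    refine continuousOn_pi.2 fun j => ContinuousOn.div ?_ ?_ fun v hv => hv
    · exact ((continuous_apply _).comp continuous_subtype_val).continuousOn
    · exact ((continuous_apply _).comp continuous_subtype_val).continuousOn
  continuousOn_invFun := (continuous_affineInv k).continuousOn

theorem exists_mem_affinePiece (x : CP n) : ∃ k, x ∈ affinePiece k := by
  induction x using Projectivization.ind with
  | h v hv => exact Function.ne_iff.1 hv

/-- The standard atlas of `ℂℙⁿ`, consisting of the `n + 1` affine charts. -/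
noncomputable instance instChartedSpace (n : ℕ) : ChartedSpace (Fin n → ℂ) (CP n) where
  atlas := Set.range affineChart
  chartAt x := affineChart (exists_mem_affinePiece x).choose
  mem_chart_source x := (exists_mem_affinePiece x).choose_spec
  chart_mem_atlas _ := Set.mem_range_self _

/-- `ℂℙⁿ` with its affine charts is a real smooth manifold. -/
instance instIsManifold (n : ℕ) : IsManifold 𝓘(ℝ, Fin n → ℂ) ∞ (CP n) := by
  refine isManifold_of_contDiffOn _ _ _ ?_
  rintro _ _ ⟨k, rfl⟩ ⟨l, rfl⟩
  have hins : ∀ i, ContDiff ℝ ∞ fun u : Fin n → ℂ => (k.insertNth (1 : ℂ) u : Fin (n + 1) → ℂ) i := by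
    intro i
    refine Fin.succAboveCases k ?_ (fun j => ?_) i
    · simpa using contDiff_const
    · simpa using contDiff_apply ℝ ℂ j
  refine contDiffOn_pi.2 fun j => ?_
  have hdiv : ContDiffOn ℝ ∞ (fun u : Fin n → ℂ =>
      (k.insertNth (1 : ℂ) u : Fin (n + 1) → ℂ) (l.succAbove j) *
        ((k.insertNth (1 : ℂ) u : Fin (n + 1) → ℂ) l)⁻¹)
      {u | (k.insertNth (1 : ℂ) u : Fin (n + 1) → ℂ) l ≠ 0} :=
    (hins (l.succAbove j)).contDiffOn.mul ((hins l).contDiffOn.inv fun u hu => hu)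
  refine (hdiv.mono fun u hu => ?_).congr fun u _ => ?_
  · exact hu.1.2
  · exact div_eq_mul_inv _ _

end CP

/-! ### Algebraic sets -/

/-- `B ⊆ ℂℙⁿ` is complex algebraic: the common zero set of homogeneous polynomials. -/
def IsComplexAlgebraic {n : ℕ} (B : Set (CP n)) : Prop :=
  ∃ F : Set (MvPolynomial (Fin (n + 1)) ℂ), (∀ f ∈ F, ∃ d : ℕ, f.IsHomogeneous d) ∧
    ∀ (v : Fin (n + 1) → ℂ) (hv : v ≠ 0),
      Projectivization.mk ℂ v hv ∈ B ↔ ∀ f ∈ F, MvPolynomial.eval v f = 0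

/-- `S` is real algebraic: the common zero set of a finite collection of real polynomials. -/
def IsRealAlgebraic {ι : Type*} (S : Set (EuclideanSpace ℝ ι)) : Prop :=
  ∃ F : Finset (MvPolynomial ι ℝ), S = {x | ∀ f ∈ F, MvPolynomial.eval (fun i => x i) f = 0}

/-- `S` is a smooth (that is, nonsingular) real algebraic set of pure dimension `d` in `ℝ^m`:
it is real algebraic, and near each of its points it is the common zero set of `m - d` polynomials
which vanish on all of `S` and whose gradients at that point are linearly independent. -/
def IsSmoothRealAlgebraic {ι : Type*} [Fintype ι] (d : ℕ) (S : Set (EuclideanSpace ℝ ι)) : Prop :=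
  IsRealAlgebraic S ∧ ∀ x ∈ S, ∃ (c : ℕ) (f : Fin c → MvPolynomial ι ℝ),
    c + d = Fintype.card ι ∧
    (∀ a, ∀ y ∈ S, MvPolynomial.eval (fun i => y i) (f a) = 0) ∧
    LinearIndependent ℝ
      (fun a => fun i => MvPolynomial.eval (fun j => x j) (MvPolynomial.pderiv i (f a))) ∧
    ∃ U : Set (EuclideanSpace ℝ ι), IsOpen U ∧ x ∈ U ∧
      ∀ y ∈ U, (∀ a, MvPolynomial.eval (fun i => y i) (f a) = 0) → y ∈ S

/-! ### The map -/

/-- The space `ℝ^{2(n+1)²}`; the coordinates with indices `(i, j, 0)` and `(i, j, 1)` are the real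
and imaginary parts of the complex coordinate `w_{ij}`. -/
abbrev AmbientSpace (n : ℕ) : Type := EuclideanSpace ℝ (Fin (n + 1) × Fin (n + 1) × Fin 2)

theorem finrank_ambientSpace (n : ℕ) : Module.finrank ℝ (AmbientSpace n) = 2 * (n + 1) ^ 2 := by
  simp
  ring

/-- The identification `ℂ^{(n+1)²} ≅ ℝ^{2(n+1)²}` through real and imaginary parts. -/
noncomputable def realCoords (n : ℕ) :
    Matrix (Fin (n + 1)) (Fin (n + 1)) ℂ ≃ₗ[ℝ] AmbientSpace n where
  toFun w := WithLp.toLp 2 fun p => if p.2.2 = 0 then (w p.1 p.2.1).re else (w p.1 p.2.1).im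
  invFun x := Matrix.of fun i j => ⟨x (i, j, 0), x (i, j, 1)⟩
  map_add' w w' := by
    ext p
    by_cases h : p.2.2 = 0 <;> simp [h]
  map_smul' t w := by
    ext p
    by_cases h : p.2.2 = 0 <;> simp [h]
  left_inv w := by
    ext i j
    simp
  right_inv x := by
    ext ⟨i, j, b⟩
    fin_cases b <;> simp

/-- The map `h : ℂℙⁿ → ℂ^{(n+1)²}`, `[z] ↦ (z_i z̄_j / ∑_l z_l z̄_l)_{ij}`. -/
noncomputable def projectorMatrix (n : ℕ) : CP n → Matrix (Fin (n + 1)) (Fin (n + 1)) ℂ :=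
  Projectivization.lift
    (fun z : {z : Fin (n + 1) → ℂ // z ≠ 0} =>
      Matrix.of fun i j => z.1 i * conj (z.1 j) / ∑ l, z.1 l * conj (z.1 l))
    (by
      rintro ⟨a, ha⟩ ⟨b, hb⟩ t (rfl : a = t • b)
      have ht : t ≠ 0 := fun h => ha (by simp [h])
      have ht' : t * conj t ≠ 0 := by simp [ht]
      ext i j
      have h1 : ∀ p q : Fin (n + 1),
          (t • b) p * conj ((t • b) q) = (t * conj t) * (b p * conj (b q)) := by
        intro p q
        simp only [Pi.smul_apply, smul_eq_mul, map_mul]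
        ring
      simp only [Matrix.of_apply, h1, ← Finset.mul_sum]
      exact mul_div_mul_left _ _ ht')

/-- The map `h : ℂℙⁿ → ℝ^{2(n+1)²}`. -/
noncomputable def projectorMap (n : ℕ) (x : CP n) : AmbientSpace n :=
  realCoords n (projectorMatrix n x)

theorem projectorMatrix_mk (n : ℕ) (z : Fin (n + 1) → ℂ) (hz : z ≠ 0) (i j : Fin (n + 1)) :
    projectorMatrix n (Projectivization.mk ℂ z hz) i j =
      z i * conj (z j) / ∑ l, z l * conj (z l) := rfl

/-- The matrices satisfying the rank-one, trace-one and Hermitian equations. -/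
def rankOneProjectors (n : ℕ) : Set (Matrix (Fin (n + 1)) (Fin (n + 1)) ℂ) :=
  {w | (∀ i j k l, w i j * w k l = w i l * w k j) ∧ ∑ i, w i i = 1 ∧ ∀ i j, w i j = conj (w j i)}

/-! The matrix `h([z])` is the orthogonal projector onto the line of `z`, so it is Hermitian of rank
one and trace one. Conversely, such a `w` has some `w_kk ≠ 0` because its trace is `1`, and the
identity `w_ik * conj (w_jk) = w_kk * w_ij` shows that `w` is the projector onto the line of its
`k`-th column (`projectorMatrix_column`).

The ratios `w_jk / w_kk` of that column recover the affine coordinates `z_j / z_k`. Hence `h` is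
injective, and an embedding since `ℂℙⁿ` is compact. The same ratios form a smooth retraction `r` on
`w_kk ≠ 0`. Keeping `r` as coordinates and subtracting `h ∘ r` from the other entries straightens
the image: in the chart `flatten`, `h` is a linear inclusion, hence an immersion.

For smoothness, `n² + n + 1` complex equations cut out the image on `w_kk ≠ 0`, and their joint real
derivative is onto (`localEquationDeriv_surjective`, `mem_range_of_localEquation`). Finally, each
column of `h([z])` is a multiple of `z`, so a homogeneous `f` vanishes at `z` exactly when it
vanishes on all columns. This is a polynomial condition on `w`. -/

/-! ### Complex coordinates on the ambient space -/

/-- The complex coordinate `w_{ij}` on the ambient space. -/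
noncomputable def entry {n : ℕ} (i j : Fin (n + 1)) : AmbientSpace n →L[ℝ] ℂ :=
  LinearMap.toContinuousLinearMap
    { toFun := fun x => (realCoords n).symm x i j
      map_add' := fun x y => by simp
      map_smul' := fun t x => by simp }

theorem entry_apply {n : ℕ} (i j : Fin (n + 1)) (x : AmbientSpace n) :
    entry i j x = ⟨x (i, j, 0), x (i, j, 1)⟩ := rfl

@[simp] theorem entry_realCoords {n : ℕ} (i j : Fin (n + 1))
    (w : Matrix (Fin (n + 1)) (Fin (n + 1)) ℂ) : entry i j (realCoords n w) = w i j := by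
  change (realCoords n).symm (realCoords n w) i j = w i j
  rw [LinearEquiv.symm_apply_apply]

theorem entry_ext {n : ℕ} {x y : AmbientSpace n} (h : ∀ i j, entry i j x = entry i j y) :
    x = y := by
  apply (realCoords n).symm.injective
  ext i j
  exact h i j

theorem contDiffOn_realCoords {n : ℕ} {E : Type*} [NormedAddCommGroup E] [NormedSpace ℝ E]
    {s : Set E} {w : E → Matrix (Fin (n + 1)) (Fin (n + 1)) ℂ}
    (hw : ∀ i j, ContDiffOn ℝ ∞ (fun a => w a i j) s) :
    ContDiffOn ℝ ∞ (fun a => realCoords n (w a)) s := by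
  rw [contDiffOn_euclidean]
  rintro ⟨i, j, b⟩
  fin_cases b
  · exact Complex.reCLM.contDiff.comp_contDiffOn (hw i j)
  · exact Complex.imCLM.contDiff.comp_contDiffOn (hw i j)

/-! ### The image -/

theorem sum_mul_conj_ne_zero {m : ℕ} {z : Fin m → ℂ} (hz : z ≠ 0) :
    ∑ l, z l * conj (z l) ≠ 0 := by
  obtain ⟨k, hk⟩ := Function.ne_iff.1 hz
  simp only [Complex.mul_conj, ← Complex.ofReal_sum]
  refine Complex.ofReal_ne_zero.2 (ne_of_gt ?_)
  exact Finset.sum_pos' (fun i _ => Complex.normSq_nonneg _)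
    ⟨k, Finset.mem_univ _, Complex.normSq_pos.2 hk⟩

theorem conj_sum_mul_conj {m : ℕ} (z : Fin m → ℂ) :
    conj (∑ l, z l * conj (z l)) = ∑ l, z l * conj (z l) := by
  simp [map_sum, mul_comm]

theorem projectorMatrix_mem_rankOneProjectors {n : ℕ} (x : CP n) :
    projectorMatrix n x ∈ rankOneProjectors n := by
  induction x using Projectivization.ind with
  | h z hz =>
    have hs := sum_mul_conj_ne_zero hz
    refine ⟨fun i j k l => ?_, ?_, fun i j => ?_⟩
    · simp only [projectorMatrix_mk]
      ring
    · simp only [projectorMatrix_mk, ← Finset.sum_div]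
      exact div_self hs
    · simp only [projectorMatrix_mk, map_div₀, conj_sum_mul_conj, map_mul, Complex.conj_conj]
      ring

/-- A matrix whose entries are determined by its `k`-th column, as for a projector of rank one,
is the image of the line spanned by that column. -/
theorem projectorMatrix_column {n : ℕ} {w : Matrix (Fin (n + 1)) (Fin (n + 1)) ℂ}
    {k : Fin (n + 1)} (hk : w k k ≠ 0) (hcol : ∀ i j, w i k * conj (w j k) = w k k * w i j)
    (htr : ∑ i, w i i = 1) :
    projectorMatrix n (Projectivization.mk ℂ (fun i => w i k) fun h => hk (congrFun h k)) = w := by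
  ext i j
  simp only [projectorMatrix_mk, hcol, ← Finset.mul_sum, htr]
  field_simp

theorem rankOneProjectors_column {n : ℕ} {w : Matrix (Fin (n + 1)) (Fin (n + 1)) ℂ}
    (hw : w ∈ rankOneProjectors n) (i j k : Fin (n + 1)) :
    w i k * conj (w j k) = w k k * w i j := by
  rw [← hw.2.2 k j, hw.1 i k k j, mul_comm]

theorem exists_diag_ne_zero {n : ℕ} {w : Matrix (Fin (n + 1)) (Fin (n + 1)) ℂ}
    (hw : w ∈ rankOneProjectors n) : ∃ k, w k k ≠ 0 := by
  by_contra! h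
  simpa [h] using hw.2.1

theorem range_projectorMatrix (n : ℕ) :
    Set.range (projectorMatrix n) = rankOneProjectors n := by
  refine Set.Subset.antisymm (Set.range_subset_iff.2 projectorMatrix_mem_rankOneProjectors) ?_
  intro w hw
  obtain ⟨k, hk⟩ := exists_diag_ne_zero hw
  exact ⟨_, projectorMatrix_column hk (fun i j => rankOneProjectors_column hw i j k) hw.2.1⟩

theorem range_projectorMap (n : ℕ) :
    Set.range (projectorMap n) = realCoords n '' rankOneProjectors n := by
  rw [← range_projectorMatrix, ← Set.range_comp]
  rfl

/-! ### The topological embedding -/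

/-- Every line meets the unit sphere of the sup norm, which is compact. -/
instance CP.instCompactSpace (n : ℕ) : CompactSpace (CP n) := by
  have hne (v : Metric.sphere (0 : Fin (n + 1) → ℂ) 1) : (v : Fin (n + 1) → ℂ) ≠ 0 :=
    ne_zero_of_mem_unit_sphere v
  have hcont : Continuous fun v : Metric.sphere (0 : Fin (n + 1) → ℂ) 1 =>
      Projectivization.mk ℂ v.1 (hne v) :=
    (CP.isQuotientMap_mk n).continuous.comp (continuous_subtype_val.subtype_mk hne)
  refine Function.Surjective.compactSpace hcont fun x => ?_
  induction x using Projectivization.ind with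
  | h z hz =>
    have hz' : ‖z‖ ≠ 0 := norm_ne_zero_iff.2 hz
    refine ⟨⟨(‖z‖⁻¹ : ℂ) • z, by simp [norm_smul, hz']⟩, ?_⟩
    rw [Projectivization.mk_eq_mk_iff']
    exact ⟨_, rfl⟩

theorem projectorMatrix_diag_ne_zero_iff {n : ℕ} (x : CP n) (k : Fin (n + 1)) :
    projectorMatrix n x k k ≠ 0 ↔ x ∈ CP.affinePiece k := by
  induction x using Projectivization.ind with
  | h z hz => simp [projectorMatrix_mk, sum_mul_conj_ne_zero hz]

theorem projectorMatrix_div_diag {n : ℕ} (x : CP n) (k : Fin (n + 1)) :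
    (fun j => projectorMatrix n x (k.succAbove j) k / projectorMatrix n x k k) =
      CP.affineCoord k x := by
  induction x using Projectivization.ind with
  | h z hz =>
    have hs := sum_mul_conj_ne_zero hz
    funext j
    simp only [projectorMatrix_mk, CP.affineCoord_mk]
    by_cases hk : z k = 0
    -- Both sides are `0`, because division by zero gives zero.
    · simp [hk]
    · have hk' : conj (z k) ≠ 0 := by simpa using hk
      field_simp

theorem projectorMatrix_injective (n : ℕ) : Function.Injective (projectorMatrix n) := by
  intro x y h
  obtain ⟨k, hx⟩ := CP.exists_mem_affinePiece x
  have hy : y ∈ CP.affinePiece k := by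
    rwa [← projectorMatrix_diag_ne_zero_iff, ← h, projectorMatrix_diag_ne_zero_iff]
  refine (CP.affineChart k).injOn hx hy ?_
  change CP.affineCoord k x = CP.affineCoord k y
  rw [← projectorMatrix_div_diag, ← projectorMatrix_div_diag, h]

theorem projectorMap_injective (n : ℕ) : Function.Injective (projectorMap n) :=
  (realCoords n).injective.comp (projectorMatrix_injective n)

theorem continuous_projectorMap (n : ℕ) : Continuous (projectorMap n) := by
  rw [(CP.isQuotientMap_mk n).continuous_iff]
  refine (PiLp.continuous_toLp 2 _).comp (continuous_pi ?_)
  have hcont (i j : Fin (n + 1)) : Continuous fun z : {z : Fin (n + 1) → ℂ // z ≠ 0} =>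
      z.1 i * conj (z.1 j) / ∑ l, z.1 l * conj (z.1 l) := by
    have h (i : Fin (n + 1)) : Continuous fun z : {z : Fin (n + 1) → ℂ // z ≠ 0} => z.1 i :=
      (continuous_apply i).comp continuous_subtype_val
    refine ((h i).mul (Complex.continuous_conj.comp (h j))).div
      (continuous_finsetSum _ fun l _ => (h l).mul (Complex.continuous_conj.comp (h l)))
      fun z => sum_mul_conj_ne_zero z.2
  rintro ⟨i, j, b⟩
  fin_cases b
  · exact Complex.continuous_re.comp (hcont i j)
  · exact Complex.continuous_im.comp (hcont i j)

/-- A continuous injection from a compact space to a Hausdorff space is a closed embedding. -/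
theorem isEmbedding_projectorMap (n : ℕ) : Topology.IsEmbedding (projectorMap n) :=
  ((continuous_projectorMap n).isClosedEmbedding (projectorMap_injective n)).isEmbedding

/-! ### The immersion -/

/-- An injective linear map between finite dimensional spaces is a coordinate inclusion. -/
theorem exists_continuousLinearEquiv_prod {E F A : Type*}
    [NormedAddCommGroup E] [NormedSpace ℝ E] [FiniteDimensional ℝ E]
    [NormedAddCommGroup F] [NormedSpace ℝ F] [FiniteDimensional ℝ F]
    [NormedAddCommGroup A] [NormedSpace ℝ A] [FiniteDimensional ℝ A]
    (f : E →ₗ[ℝ] A) (hf : Function.Injective f)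
    (hdim : Module.finrank ℝ E + Module.finrank ℝ F = Module.finrank ℝ A) :
    ∃ e : (E × F) ≃L[ℝ] A, ∀ u, e (u, 0) = f u := by
  obtain ⟨q, hq⟩ := Submodule.exists_isCompl (LinearMap.range f)
  have hE := LinearMap.finrank_range_of_inj hf
  have hA := Submodule.finrank_add_eq_of_isCompl hq
  have e₂ : F ≃ₗ[ℝ] q := LinearEquiv.ofFinrankEq F q (by omega)
  refine ⟨(((LinearEquiv.ofInjective f hf).prodCongr e₂).trans
    (Submodule.prodEquivOfIsCompl _ q hq)).toContinuousLinearEquiv, fun u => ?_⟩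
  simp

/-- The matrix obtained by replacing the `k`-th column of `w`. -/
def Matrix.replaceColumn {n : ℕ} (k : Fin (n + 1)) (w : Matrix (Fin (n + 1)) (Fin (n + 1)) ℂ)
    (c : Fin (n + 1) → ℂ) : Matrix (Fin (n + 1)) (Fin (n + 1)) ℂ :=
  Matrix.of fun i j => if j = k then c i else w i j

/-- Case distinction on the entries of a matrix: the entry `(k, k)`, the rest of the `k`-th column,
and the other columns. -/
theorem forall_entries {n : ℕ} (k : Fin (n + 1)) {P : Fin (n + 1) → Fin (n + 1) → Prop}
    (h₁ : P k k) (h₂ : ∀ j, P (k.succAbove j) k) (h₃ : ∀ i j, j ≠ k → P i j) : ∀ i j, P i j := by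
  intro i j
  by_cases hj : j = k
  · subst hj
    exact Fin.succAboveCases j h₁ h₂ i
  · exact h₃ i j hj

section ReplaceColumn

variable {n : ℕ} (k : Fin (n + 1)) (w : Matrix (Fin (n + 1)) (Fin (n + 1)) ℂ) (t : ℂ)
  (u : Fin n → ℂ)

@[simp] theorem Matrix.replaceColumn_diag :
    w.replaceColumn k (k.insertNth t u) k k = t := by simp [Matrix.replaceColumn]

@[simp] theorem Matrix.replaceColumn_succAbove (j : Fin n) :
    w.replaceColumn k (k.insertNth t u) (k.succAbove j) k = u j := by simp [Matrix.replaceColumn]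

theorem Matrix.replaceColumn_of_ne (c : Fin (n + 1) → ℂ) {i j : Fin (n + 1)} (h : j ≠ k) :
    w.replaceColumn k c i j = w i j := by simp [Matrix.replaceColumn, h]

theorem contDiffOn_replaceColumn {E : Type*} [NormedAddCommGroup E] [NormedSpace ℝ E]
    {s : Set E} {w : E → Matrix (Fin (n + 1)) (Fin (n + 1)) ℂ} {t : E → ℂ} {u : E → Fin n → ℂ}
    (hw : ∀ i j, ContDiffOn ℝ ∞ (fun a => w a i j) s) (ht : ContDiffOn ℝ ∞ t s)
    (hu : ContDiffOn ℝ ∞ u s) :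
    ContDiffOn ℝ ∞
      (fun a => realCoords n ((w a).replaceColumn k (k.insertNth (t a) (u a)))) s := by
  refine contDiffOn_realCoords (forall_entries k ?_ (fun j => ?_) fun i j hj => ?_)
  · simpa using ht
  · simpa using contDiffOn_pi.1 hu j
  · simpa [Matrix.replaceColumn_of_ne k _ _ hj] using hw i j

end ReplaceColumn

/-! ### Straightening the image on `w_kk ≠ 0`. -/

/-- The map `h` in the `k`-th affine chart. -/
noncomputable def chartedProjector {n : ℕ} (k : Fin (n + 1)) (u : Fin n → ℂ) :
    Matrix (Fin (n + 1)) (Fin (n + 1)) ℂ :=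
  projectorMatrix n (CP.affineInv k u)

theorem contDiff_chartedProjector {n : ℕ} (k i j : Fin (n + 1)) :
    ContDiff ℝ ∞ fun u : Fin n → ℂ => chartedProjector k u i j := by
  have hins (i : Fin (n + 1)) :
      ContDiff ℝ ∞ fun u : Fin n → ℂ => (k.insertNth (1 : ℂ) u : Fin (n + 1) → ℂ) i := by
    refine Fin.succAboveCases k ?_ (fun j => ?_) i
    · simpa using contDiff_const
    · simpa using contDiff_apply ℝ ℂ j
  have hconj (i : Fin (n + 1)) := Complex.conjCLE.contDiff.comp (hins i)
  simp only [chartedProjector, CP.affineInv, projectorMatrix_mk, div_eq_mul_inv]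
  exact ((hins i).mul (hconj j)).mul ((ContDiff.sum fun l _ => (hins l).mul (hconj l)).inv
    fun u => sum_mul_conj_ne_zero (CP.insertNth_ne_zero k u))

theorem chartedProjector_div_diag {n : ℕ} (k : Fin (n + 1)) (u : Fin n → ℂ) (j : Fin n) :
    chartedProjector k u (k.succAbove j) k / chartedProjector k u k k = u j :=
  (congrFun (projectorMatrix_div_diag (CP.affineInv k u) k) j).trans
    (congrFun ((CP.affineChart k).right_inv (Set.mem_univ u)) j)

/-- The left inverse `w ↦ (w_{jk} / w_{kk})_{j ≠ k}` of `h` in the `k`-th affine chart. -/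
noncomputable def affineRetraction {n : ℕ} (k : Fin (n + 1)) (x : AmbientSpace n) : Fin n → ℂ :=
  fun j => entry (k.succAbove j) k x / entry k k x

theorem contDiffOn_affineRetraction {n : ℕ} (k : Fin (n + 1)) :
    ContDiffOn ℝ ∞ (affineRetraction k) {x : AmbientSpace n | entry k k x ≠ 0} := by
  refine contDiffOn_pi.2 fun j => ?_
  simp only [affineRetraction, div_eq_mul_inv]
  exact (entry _ _).contDiff.contDiffOn.mul ((entry _ _).contDiff.contDiffOn.inv fun x hx => hx)

theorem affineRetraction_chartedProjector {n : ℕ} (k : Fin (n + 1)) (u : Fin n → ℂ) :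
    affineRetraction k (realCoords n (chartedProjector k u)) = u := by
  funext j
  simpa [affineRetraction] using chartedProjector_div_diag k u j

/-- The entries of the `k`-th column off the diagonal. -/
noncomputable def columnEntries {n : ℕ} (k : Fin (n + 1)) (y : AmbientSpace n) : Fin n → ℂ :=
  fun j => entry (k.succAbove j) k y

theorem contDiff_columnEntries {n : ℕ} (k : Fin (n + 1)) :
    ContDiff ℝ ∞ (columnEntries (n := n) k) :=
  contDiff_pi.2 fun _ => (entry _ _).contDiff

/-- The chart of the ambient space on `w_{kk} ≠ 0` that takes the affine coordinates as the entries
of the `k`-th column off the diagonal, and flattens the other entries along the image of `h`. -/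
noncomputable def flatten {n : ℕ} (k : Fin (n + 1)) (x : AmbientSpace n) : AmbientSpace n :=
  realCoords n (Matrix.replaceColumn k
    (Matrix.of fun i j => entry i j x - chartedProjector k (affineRetraction k x) i j)
    (k.insertNth (entry k k x - chartedProjector k (affineRetraction k x) k k)
      (affineRetraction k x)))

/-- The inverse of `flatten`. -/
noncomputable def unflatten {n : ℕ} (k : Fin (n + 1)) (y : AmbientSpace n) : AmbientSpace n :=
  realCoords n (Matrix.replaceColumn k
    (Matrix.of fun i j => entry i j y + chartedProjector k (columnEntries k y) i j)
    (k.insertNth (entry k k y + chartedProjector k (columnEntries k y) k k)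
      ((entry k k y + chartedProjector k (columnEntries k y) k k) • columnEntries k y)))

theorem columnEntries_flatten {n : ℕ} (k : Fin (n + 1)) (x : AmbientSpace n) :
    columnEntries k (flatten k x) = affineRetraction k x := by
  funext j
  simp [columnEntries, flatten]

theorem entry_unflatten_diag {n : ℕ} (k : Fin (n + 1)) (y : AmbientSpace n) :
    entry k k (unflatten k y) = entry k k y + chartedProjector k (columnEntries k y) k k := by
  simp [unflatten]

/-- The rest of the `k`-th column of `unflatten k y` is `columnEntries k y` scaled by the new
diagonal entry, which cancels in the ratios. -/
theorem affineRetraction_unflatten {n : ℕ} (k : Fin (n + 1)) {y : AmbientSpace n}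
    (hy : entry k k (unflatten k y) ≠ 0) :
    affineRetraction k (unflatten k y) = columnEntries k y := by
  have hy' := entry_unflatten_diag k y ▸ hy
  funext j
  simp only [affineRetraction]
  rw [entry_unflatten_diag]
  simp [unflatten, hy']

theorem unflatten_flatten {n : ℕ} (k : Fin (n + 1)) {x : AmbientSpace n}
    (hx : entry k k x ≠ 0) : unflatten k (flatten k x) = x := by
  have hdiag : entry k k (flatten k x) +
      chartedProjector k (affineRetraction k x) k k = entry k k x := by
    simp [flatten]
  refine entry_ext (forall_entries k ?_ (fun j => ?_) fun i j hj => ?_)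
  · rw [entry_unflatten_diag, columnEntries_flatten, hdiag]
  · rw [unflatten, columnEntries_flatten, hdiag]
    simp [affineRetraction, mul_div_cancel₀ _ hx]
  · rw [unflatten, columnEntries_flatten]
    simp [Matrix.replaceColumn_of_ne k _ _ hj, flatten]

theorem flatten_unflatten {n : ℕ} (k : Fin (n + 1)) {y : AmbientSpace n}
    (hy : entry k k (unflatten k y) ≠ 0) : flatten k (unflatten k y) = y := by
  refine entry_ext (forall_entries k ?_ (fun j => ?_) fun i j hj => ?_)
  · rw [flatten, affineRetraction_unflatten k hy, entry_unflatten_diag]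
    simp
  · rw [flatten, affineRetraction_unflatten k hy]
    simp [columnEntries]
  · rw [flatten, affineRetraction_unflatten k hy]
    simp [Matrix.replaceColumn_of_ne k _ _ hj, unflatten]

theorem contDiffOn_flatten {n : ℕ} (k : Fin (n + 1)) :
    ContDiffOn ℝ ∞ (flatten k) {x : AmbientSpace n | entry k k x ≠ 0} := by
  have hr := contDiffOn_affineRetraction (n := n) k
  have h (i j : Fin (n + 1)) : ContDiffOn ℝ ∞
      (fun x => entry i j x - chartedProjector k (affineRetraction k x) i j)
      {x : AmbientSpace n | entry k k x ≠ 0} :=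
    (entry i j).contDiff.contDiffOn.sub ((contDiff_chartedProjector k i j).comp_contDiffOn hr)
  exact contDiffOn_replaceColumn k h (h k k) hr

theorem contDiff_unflatten {n : ℕ} (k : Fin (n + 1)) :
    ContDiff ℝ ∞ (unflatten (n := n) k) := by
  have hc := contDiff_columnEntries (n := n) k
  have h (i j : Fin (n + 1)) : ContDiff ℝ ∞
      (fun y : AmbientSpace n => entry i j y + chartedProjector k (columnEntries k y) i j) :=
    (entry i j).contDiff.add ((contDiff_chartedProjector k i j).comp hc)
  rw [← contDiffOn_univ]
  exact contDiffOn_replaceColumn k (fun i j => (h i j).contDiffOn) (h k k).contDiffOn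
    ((h k k).smul hc).contDiffOn

theorem isOpen_diag_ne_zero {n : ℕ} (k : Fin (n + 1)) :
    IsOpen {x : AmbientSpace n | entry k k x ≠ 0} :=
  isOpen_ne_fun (entry k k).continuous continuous_const

/-- `flatten` as a chart of the ambient space. -/
noncomputable def flatteningChart {n : ℕ} (k : Fin (n + 1)) :
    OpenPartialHomeomorph (AmbientSpace n) (AmbientSpace n) where
  toFun := flatten k
  invFun := unflatten k
  source := {x | entry k k x ≠ 0}
  target := {y | entry k k (unflatten k y) ≠ 0}
  map_source' x hx := by
    change entry k k (unflatten k (flatten k x)) ≠ 0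
    rwa [unflatten_flatten k hx]
  map_target' y hy := hy
  left_inv' x hx := unflatten_flatten k hx
  right_inv' y hy := flatten_unflatten k hy
  open_source := isOpen_diag_ne_zero k
  open_target := (isOpen_diag_ne_zero k).preimage (contDiff_unflatten k).continuous
  continuousOn_toFun := (contDiffOn_flatten k).continuousOn
  continuousOn_invFun := (contDiff_unflatten k).continuous.continuousOn

theorem flatteningChart_mem_maximalAtlas {n : ℕ} (k : Fin (n + 1)) :
    flatteningChart k ∈ IsManifold.maximalAtlas 𝓘(ℝ, AmbientSpace n) ∞ (AmbientSpace n) := by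
  refine StructureGroupoid.mem_maximalAtlas_of_mem_groupoid _ ?_
  rw [contDiffGroupoid, mem_groupoid_of_pregroupoid]
  constructor
  · change ContDiffOn ℝ ∞ (flatten k) _
    exact (contDiffOn_flatten k).mono fun x hx => hx.1
  · exact (contDiff_unflatten k).contDiffOn

/-- The inclusion of `ℂⁿ` as the `k`-th column, with zero on the diagonal. -/
noncomputable def columnInclusion {n : ℕ} (k : Fin (n + 1)) : (Fin n → ℂ) →ₗ[ℝ] AmbientSpace n where
  toFun u := realCoords n (Matrix.replaceColumn k 0 (k.insertNth 0 u))
  map_add' u v := entry_ext (forall_entries k (by simp) (fun j => by simp)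
    fun i j hj => by simp [Matrix.replaceColumn_of_ne k _ _ hj])
  map_smul' t u := entry_ext (forall_entries k (by simp) (fun j => by simp)
    fun i j hj => by simp [Matrix.replaceColumn_of_ne k _ _ hj])

theorem columnInclusion_injective {n : ℕ} (k : Fin (n + 1)) :
    Function.Injective (columnInclusion k) := by
  intro u v h
  funext j
  simpa [columnInclusion] using congrArg (entry (k.succAbove j) k) h

/-- On the image the retraction returns `u`, so every subtracted entry cancels and only the column
`u` remains. -/
theorem flatten_chartedProjector {n : ℕ} (k : Fin (n + 1)) (u : Fin n → ℂ) :
    flatten k (realCoords n (chartedProjector k u)) = columnInclusion k u := by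
  rw [flatten, affineRetraction_chartedProjector]
  refine entry_ext (forall_entries k ?_ (fun j => ?_) fun i j hj => ?_) <;>
    simp [columnInclusion]
  simp [Matrix.replaceColumn_of_ne k _ _ hj]

/-- The real codimension of the image is `2(n+1)² - 2n = 2(n² + n + 1)`; this fixes the
complementary factor in the local form of the immersion. -/
theorem finrank_coordinates_add (n : ℕ) :
    Module.finrank ℝ (Fin n → ℂ) +
      Module.finrank ℝ (EuclideanSpace ℝ (Fin (2 * (n ^ 2 + n + 1)))) =
      Module.finrank ℝ (AmbientSpace n) := by
  rw [finrank_ambientSpace, finrank_euclideanSpace_fin, Module.finrank_pi_fintype]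
  simp only [Complex.finrank_real_complex, Finset.sum_const, Finset.card_univ, Fintype.card_fin,
    smul_eq_mul]
  ring

theorem isImmersion_projectorMap (n : ℕ) :
    Manifold.IsImmersion 𝓘(ℝ, Fin n → ℂ) 𝓘(ℝ, AmbientSpace n) ∞ (projectorMap n) := by
  refine ⟨EuclideanSpace ℝ (Fin (2 * (n ^ 2 + n + 1))), inferInstance, inferInstance, fun x => ?_⟩
  obtain ⟨k, hk⟩ := CP.exists_mem_affinePiece x
  obtain ⟨e, he⟩ := exists_continuousLinearEquiv_prod (columnInclusion k)
    (columnInclusion_injective k) (finrank_coordinates_add n)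
  have hmem {y : CP n} (hy : y ∈ CP.affinePiece k) : entry k k (projectorMap n y) ≠ 0 := by
    rwa [projectorMap, entry_realCoords, projectorMatrix_diag_ne_zero_iff]
  refine .mk_of_charts e (CP.affineChart k) (flatteningChart k) hk (hmem hk)
    (IsManifold.subset_maximalAtlas (Set.mem_range_self k))
    (flatteningChart_mem_maximalAtlas k) (fun y hy => hmem hy) fun u _ => ?_
  exact (flatten_chartedProjector k u).trans (he u).symm

theorem isSmoothEmbedding_projectorMap (n : ℕ) :
    Manifold.IsSmoothEmbedding 𝓘(ℝ, Fin n → ℂ) 𝓘(ℝ, AmbientSpace n) ∞ (projectorMap n) :=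
  ⟨isImmersion_projectorMap n, isEmbedding_projectorMap n⟩

/-! ### Real algebraic sets -/

/-- Hilbert's basis theorem: the ideal spanned by `F` is already spanned by a finite subset of `F`.
-/
theorem isRealAlgebraic_of_set {ι : Type*} [Finite ι] (F : Set (MvPolynomial ι ℝ)) :
    IsRealAlgebraic {x : EuclideanSpace ℝ ι | ∀ f ∈ F, MvPolynomial.eval (fun i => x i) f = 0} := by
  have hfg : (Ideal.span F).FG := IsNoetherian.noetherian _
  obtain ⟨G, hGF, hG⟩ := (Submodule.fg_span_iff_fg_span_finset_subset F).1 hfg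
  refine ⟨G, Set.ext fun x => ⟨fun h f hf => h f (hGF hf), fun h f hf => ?_⟩⟩
  have hle : Ideal.span (G : Set (MvPolynomial ι ℝ)) ≤
      RingHom.ker (MvPolynomial.eval fun i => x i) := Ideal.span_le.2 fun g hg => h g hg
  have hf' : f ∈ Ideal.span F := Submodule.subset_span hf
  rw [Ideal.span, hG] at hf'
  exact hle hf'

/-- A complex valued function on `ℝ^ι` whose real and imaginary parts are polynomials. -/
def IsPolynomialMap {ι : Type*} (φ : EuclideanSpace ℝ ι → ℂ) : Prop :=
  ∃ p q : MvPolynomial ι ℝ, ∀ x, φ x =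
    ⟨MvPolynomial.eval (fun i => x i) p, MvPolynomial.eval (fun i => x i) q⟩

namespace IsPolynomialMap

variable {ι : Type*} {φ ψ : EuclideanSpace ℝ ι → ℂ}

theorem const (c : ℂ) : IsPolynomialMap fun _ : EuclideanSpace ℝ ι => c :=
  ⟨MvPolynomial.C c.re, MvPolynomial.C c.im, fun x => by simp⟩

theorem add (hφ : IsPolynomialMap φ) (hψ : IsPolynomialMap ψ) :
    IsPolynomialMap fun x => φ x + ψ x := by
  obtain ⟨p, q, h⟩ := hφ
  obtain ⟨p', q', h'⟩ := hψ
  exact ⟨p + p', q + q', fun x => by simp [h, h', Complex.ext_iff]⟩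

theorem mul (hφ : IsPolynomialMap φ) (hψ : IsPolynomialMap ψ) :
    IsPolynomialMap fun x => φ x * ψ x := by
  obtain ⟨p, q, h⟩ := hφ
  obtain ⟨p', q', h'⟩ := hψ
  exact ⟨p * p' - q * q', p * q' + q * p', fun x => by simp [h, h', Complex.ext_iff]⟩

theorem sub (hφ : IsPolynomialMap φ) (hψ : IsPolynomialMap ψ) :
    IsPolynomialMap fun x => φ x - ψ x := by
  simpa [sub_eq_add_neg] using hφ.add ((const (-1)).mul hψ)

theorem conjugate (hφ : IsPolynomialMap φ) : IsPolynomialMap fun x => conj (φ x) := by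
  obtain ⟨p, q, h⟩ := hφ
  exact ⟨p, -q, fun x => by simp [h, Complex.ext_iff]⟩

theorem sum {κ : Type*} (s : Finset κ) {φ : κ → EuclideanSpace ℝ ι → ℂ}
    (h : ∀ a, IsPolynomialMap (φ a)) : IsPolynomialMap fun x => ∑ a ∈ s, φ a x := by
  classical
  induction s using Finset.induction_on with
  | empty => simpa using const 0
  | insert a s ha ih => simpa [Finset.sum_insert ha] using (h a).add ih

theorem eval {κ : Type*} {φ : κ → EuclideanSpace ℝ ι → ℂ} (h : ∀ a, IsPolynomialMap (φ a))
    (f : MvPolynomial κ ℂ) : IsPolynomialMap fun x => MvPolynomial.eval (fun a => φ a x) f := by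
  induction f using MvPolynomial.induction_on with
  | C c => simpa using const c
  | add f g hf hg => simpa using hf.add hg
  | mul_X f a hf => simpa using hf.mul (h a)

end IsPolynomialMap

theorem isPolynomialMap_entry {n : ℕ} (i j : Fin (n + 1)) :
    IsPolynomialMap (entry (n := n) i j) :=
  ⟨MvPolynomial.X (i, j, 0), MvPolynomial.X (i, j, 1), fun x => by simp [entry_apply]⟩

theorem isRealAlgebraic_of_isPolynomialMap {ι : Type*} [Finite ι]
    {Φ : Set (EuclideanSpace ℝ ι → ℂ)} (h : ∀ φ ∈ Φ, IsPolynomialMap φ) :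
    IsRealAlgebraic {x | ∀ φ ∈ Φ, φ x = 0} := by
  choose! p q hpq using h
  convert isRealAlgebraic_of_set (p '' Φ ∪ q '' Φ) using 1
  ext x
  simp only [Set.mem_ofPred_eq, Set.mem_union, or_imp, forall_and, Set.forall_mem_image]
  rw [← forall₂_and]
  refine forall₂_congr fun φ hφ => ?_
  rw [hpq φ hφ, Complex.ext_iff]
  rfl

/-! ### Algebraicity of the image of `h` and of the images of algebraic subsets. -/

theorem mem_range_projectorMap_iff {n : ℕ} (x : AmbientSpace n) :
    x ∈ Set.range (projectorMap n) ↔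
      (∀ i j k l, entry i j x * entry k l x - entry i l x * entry k j x = 0) ∧
      ∑ i, entry i i x - 1 = 0 ∧ ∀ i j, entry i j x - conj (entry j i x) = 0 := by
  rw [range_projectorMap, LinearEquiv.image_eq_preimage_symm]
  simp only [sub_eq_zero]
  rfl

theorem isRealAlgebraic_range_projectorMap (n : ℕ) :
    IsRealAlgebraic (Set.range (projectorMap n)) := by
  have e := isPolynomialMap_entry (n := n)
  convert isRealAlgebraic_of_isPolynomialMap
    (Φ := Set.range (fun (t : Fin (n + 1) × Fin (n + 1) × Fin (n + 1) × Fin (n + 1)) x =>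
        entry t.1 t.2.1 x * entry t.2.2.1 t.2.2.2 x - entry t.1 t.2.2.2 x * entry t.2.2.1 t.2.1 x) ∪
      ({fun x => ∑ i, entry i i x - 1} ∪
        Set.range fun (t : Fin (n + 1) × Fin (n + 1)) x =>
          entry t.1 t.2 x - conj (entry t.2 t.1 x))) ?_ using 1
  · ext x
    rw [mem_range_projectorMap_iff]
    simp only [Set.mem_ofPred_eq, Set.mem_union, or_imp, forall_and, Set.forall_mem_range,
      Set.mem_singleton_iff, forall_eq, Prod.forall]
  · rintro φ (⟨t, rfl⟩ | rfl | ⟨t, rfl⟩)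
    · exact ((e _ _).mul (e _ _)).sub ((e _ _).mul (e _ _))
    · exact (IsPolynomialMap.sum _ fun i => e i i).sub (.const 1)
    · exact (e _ _).sub (e _ _).conjugate

theorem IsRealAlgebraic.inter {ι : Type*} {S T : Set (EuclideanSpace ℝ ι)}
    (hS : IsRealAlgebraic S) (hT : IsRealAlgebraic T) : IsRealAlgebraic (S ∩ T) := by
  classical
  obtain ⟨F, rfl⟩ := hS
  obtain ⟨G, rfl⟩ := hT
  refine ⟨F ∪ G, Set.ext fun x => ?_⟩
  simp only [Set.mem_inter_iff, Set.mem_ofPred_eq, Finset.mem_union, or_imp, forall_and]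

theorem MvPolynomial.IsHomogeneous.eval_smul_eq {σ R : Type*} [CommSemiring R]
    {f : MvPolynomial σ R} {d : ℕ} (hf : f.IsHomogeneous d) (t : R) (v : σ → R) :
    MvPolynomial.eval (fun i => v i * t) f = t ^ d * MvPolynomial.eval v f := by
  rw [MvPolynomial.eval_eq, MvPolynomial.eval_eq, Finset.mul_sum]
  refine Finset.sum_congr rfl fun m hm => ?_
  have hd : ∑ i ∈ m.support, m i = d := by
    simpa [Finsupp.weight_apply, Finsupp.sum] using hf (MvPolynomial.mem_support_iff.1 hm)
  simp only [mul_pow, Finset.prod_mul_distrib, Finset.prod_pow_eq_pow_sum, hd]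
  ring

/-- The `k`-th column of `h([z])` is `z` times `conj (z_k) / ∑ z_l * conj (z_l)`. Imposing each `f`
on all columns avoids a choice of `k`: some `z_k` is nonzero, and that column detects `f(z) = 0`. -/
theorem isRealAlgebraic_image_projectorMap {n : ℕ} {B : Set (CP n)} (hB : IsComplexAlgebraic B) :
    IsRealAlgebraic (projectorMap n '' B) := by
  obtain ⟨F, hF, hBF⟩ := hB
  have halg := isRealAlgebraic_of_isPolynomialMap
    (Φ := Set.range fun (t : F × Fin (n + 1)) (x : AmbientSpace n) =>
      MvPolynomial.eval (fun i => entry i t.2 x) t.1.1)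
    (by
      rintro _ ⟨t, rfl⟩
      exact IsPolynomialMap.eval (fun i => isPolynomialMap_entry i t.2) _)
  convert (isRealAlgebraic_range_projectorMap n).inter halg using 1
  rw [← Set.image_preimage_eq_range_inter]
  congr 1
  ext x
  induction x using Projectivization.ind with
  | h z hz =>
    have hs := sum_mul_conj_ne_zero hz
    have heval (f : F) (k : Fin (n + 1)) :
        ∃ d, MvPolynomial.eval (fun i => entry i k (projectorMap n (.mk ℂ z hz))) f.1 =
          (conj (z k) / ∑ l, z l * conj (z l)) ^ d * MvPolynomial.eval z f.1 := by
      obtain ⟨d, hd⟩ := hF f.1 f.2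
      refine ⟨d, ?_⟩
      rw [← hd.eval_smul_eq]
      simp only [projectorMap, entry_realCoords, projectorMatrix_mk, mul_div_assoc]
    rw [hBF, Set.mem_preimage, Set.mem_ofPred_eq, Set.forall_mem_range]
    constructor
    · rintro h ⟨f, k⟩
      obtain ⟨d, hd⟩ := heval f k
      simp only [hd, h f.1 f.2, mul_zero]
    · intro h f hf
      obtain ⟨k, hk⟩ := Function.ne_iff.1 hz
      obtain ⟨d, hd⟩ := heval ⟨f, hf⟩ k
      have h0 := h (⟨f, hf⟩, k)
      simp only [hd] at h0
      refine (mul_eq_zero.1 h0).resolve_left (pow_ne_zero _ (div_ne_zero ?_ hs))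
      simpa using hk

/-! ### Smoothness of the image -/

/-- Links the formal gradient to derivatives along lines, so that the latter can be computed
directly from complex equations. -/
theorem MvPolynomial.hasDerivAt_eval_add_mul {ι : Type*} [Fintype ι] (f : MvPolynomial ι ℝ)
    (x v : ι → ℝ) :
    HasDerivAt (fun t : ℝ => MvPolynomial.eval (fun i => x i + t * v i) f)
      (∑ i, MvPolynomial.eval x (MvPolynomial.pderiv i f) * v i) 0 := by
  classical
  induction f using MvPolynomial.induction_on with
  | C c => simpa using hasDerivAt_const (0 : ℝ) c
  | add f g hf hg => simpa [add_mul, Finset.sum_add_distrib] using hf.fun_add hg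
  | mul_X f a hf =>
    have hX : HasDerivAt (fun t : ℝ => x a + t * v a) (v a) 0 := by
      simpa using ((hasDerivAt_id (0 : ℝ)).mul_const (v a)).const_add (x a)
    have h := hf.fun_mul hX
    simp only [zero_mul, add_zero] at h
    simp only [map_mul, MvPolynomial.eval_X]
    refine h.congr_deriv ?_
    symm
    simp only [Derivation.leibniz, MvPolynomial.pderiv_X, smul_eq_mul, map_add, map_mul,
        MvPolynomial.eval_X, add_mul, Finset.sum_add_distrib, Finset.sum_mul]
    rw [add_comm]
    congr 1
    · exact Finset.sum_congr rfl fun i _ => by ring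
    · rw [Finset.sum_eq_single a]
      · simp
      · intro b _ hb
        simp [hb.symm]
      · simp

/-- Rows of a matrix that is onto are linearly independent. -/
theorem linearIndependent_of_forall_exists_sum_mul_eq {ι κ : Type*} [Fintype ι] [Fintype κ]
    {g : κ → ι → ℝ} (h : ∀ T : κ → ℝ, ∃ v : ι → ℝ, ∀ a, ∑ i, g a i * v i = T a) :
    LinearIndependent ℝ g := by
  rw [Fintype.linearIndependent_iff]
  intro c hc
  -- Taking the coefficients of the relation as the target turns `∑ c_a²` into the pairing of the
  -- zero combination with `v`.
  obtain ⟨v, hv⟩ := h c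
  have hsum : ∑ a, c a * c a = 0 := by
    calc ∑ a, c a * c a = ∑ a, c a * ∑ i, g a i * v i := by simp only [hv]
      _ = ∑ i, (∑ a, c a • g a) i * v i := by
        simp only [Finset.mul_sum, Finset.sum_apply, Pi.smul_apply, smul_eq_mul, Finset.sum_mul]
        rw [Finset.sum_comm]
        exact Finset.sum_congr rfl fun i _ => Finset.sum_congr rfl fun a _ => by ring
      _ = 0 := by simp only [hc, Pi.zero_apply, zero_mul, Finset.sum_const_zero]
  intro a
  simpa using (Finset.sum_eq_zero_iff_of_nonneg fun a _ => mul_self_nonneg (c a)).1 hsum a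
    (Finset.mem_univ a)

/-- Smoothness from complex valued local equations whose joint derivative is onto. -/
theorem isSmoothRealAlgebraic_of_isPolynomialMap {ι κ : Type*} [Fintype ι] [Fintype κ] {d : ℕ}
    {S : Set (EuclideanSpace ℝ ι)} (hS : IsRealAlgebraic S)
    (hcard : 2 * Fintype.card κ + d = Fintype.card ι)
    (h : ∀ x ∈ S, ∃ (φ : κ → EuclideanSpace ℝ ι → ℂ) (D : EuclideanSpace ℝ ι → κ → ℂ),
      (∀ a, IsPolynomialMap (φ a)) ∧ (∀ a, ∀ y ∈ S, φ a y = 0) ∧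
      (∀ v a, HasDerivAt (fun t : ℝ => φ a (x + t • v)) (D v a) 0) ∧
      Function.Surjective D ∧
      ∃ U : Set (EuclideanSpace ℝ ι), IsOpen U ∧ x ∈ U ∧ ∀ y ∈ U, (∀ a, φ a y = 0) → y ∈ S) :
    IsSmoothRealAlgebraic d S := by
  refine ⟨hS, fun x hx => ?_⟩
  obtain ⟨φ, D, hφ, hφS, hD, hsurj, U, hU, hxU, hUS⟩ := h x hx
  choose p q hpq using hφ
  let e : Fin (Fintype.card (κ ⊕ κ)) ≃ κ ⊕ κ := (Fintype.equivFin _).symm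
  have hre (a : κ) (y : EuclideanSpace ℝ ι) :
      (φ a y).re = MvPolynomial.eval (fun i => y i) (p a) := by rw [hpq]
  have him (a : κ) (y : EuclideanSpace ℝ ι) :
      (φ a y).im = MvPolynomial.eval (fun i => y i) (q a) := by rw [hpq]
  refine ⟨_, fun a => Sum.elim p q (e a), ?_, fun a y hy => ?_, ?_, U, hU, hxU,
    fun y hy hzero => hUS y hy fun a => ?_⟩
  · rw [← hcard, Fintype.card_sum, two_mul]
  · beta_reduce
    rcases e a with b | b
    · exact (hre b y).symm.trans (by rw [hφS b y hy, Complex.zero_re])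
    · exact (him b y).symm.trans (by rw [hφS b y hy, Complex.zero_im])
  · refine LinearIndependent.comp (R := ℝ) (ι' := Fin (Fintype.card (κ ⊕ κ)))
      (v := fun s : κ ⊕ κ => fun i =>
        MvPolynomial.eval (fun j => x j) (MvPolynomial.pderiv i (Sum.elim p q s)))
      (linearIndependent_of_forall_exists_sum_mul_eq fun T => ?_) e e.injective
    -- The target pairs the values prescribed for the real and imaginary parts; uniqueness of
    -- derivatives then evaluates the gradients on `v`.
    obtain ⟨v, hv⟩ := hsurj fun a => ⟨T (.inl a), T (.inr a)⟩
    refine ⟨fun i => v i, ?_⟩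
    rintro (a | a)
    · have h₁ := Complex.reCLM.hasFDerivAt.comp_hasDerivAt (0 : ℝ) (hD v a)
      have h₂ := MvPolynomial.hasDerivAt_eval_add_mul (p a) (fun i => x i) (fun i => v i)
      rw [hv] at h₁
      exact h₂.unique (h₁.congr_of_eventuallyEq (.of_forall fun t => (hre a (x + t • v)).symm))
    · have h₁ := Complex.imCLM.hasFDerivAt.comp_hasDerivAt (0 : ℝ) (hD v a)
      have h₂ := MvPolynomial.hasDerivAt_eval_add_mul (q a) (fun i => x i) (fun i => v i)
      rw [hv] at h₁
      exact h₂.unique (h₁.congr_of_eventuallyEq (.of_forall fun t => (him a (x + t • v)).symm))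
  · apply Complex.ext
    · rw [hre]
      simpa using hzero (e.symm (.inl a))
    · rw [him]
      simpa using hzero (e.symm (.inr a))

/-! ### Local equations of the image and their derivative. -/

/-- Index set of the local equations of the image of `h` on `w_{kk} ≠ 0`. -/
abbrev EquationIndex (n : ℕ) : Type := (Fin n × Fin n) ⊕ Fin n ⊕ Unit

section LocalEquations

variable {n : ℕ} (k : Fin (n + 1))

/-- The local equations of the image of `h` on `w_{kk} ≠ 0`: vanishing minors, Hermitian symmetry of
the `k`-th column, and an equation whose real and imaginary parts are
`Re (tr w) = 1` and `Im w_{kk} = 0`. -/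
noncomputable def localEquation : EquationIndex n → AmbientSpace n → ℂ
  | .inl (i, j) => fun x => entry k k x * entry (k.succAbove i) (k.succAbove j) x -
      entry (k.succAbove i) k x * entry k (k.succAbove j) x
  | .inr (.inl j) => fun x => entry k (k.succAbove j) x - conj (entry (k.succAbove j) k x)
  | .inr (.inr _) => fun x => (1 / 2 : ℂ) * ((∑ i, entry i i x + conj (∑ i, entry i i x)) +
      (entry k k x - conj (entry k k x))) - 1

/-- The derivative at `x` of the local equations. -/
noncomputable def localEquationDeriv (x v : AmbientSpace n) : EquationIndex n → ℂ
  | .inl (i, j) => (entry k k v * entry (k.succAbove i) (k.succAbove j) x +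
        entry k k x * entry (k.succAbove i) (k.succAbove j) v) -
      (entry (k.succAbove i) k v * entry k (k.succAbove j) x +
        entry (k.succAbove i) k x * entry k (k.succAbove j) v)
  | .inr (.inl j) => entry k (k.succAbove j) v - conj (entry (k.succAbove j) k v)
  | .inr (.inr _) => (1 / 2 : ℂ) * ((∑ i, entry i i v + conj (∑ i, entry i i v)) +
      (entry k k v - conj (entry k k v)))

theorem isPolynomialMap_localEquation (a : EquationIndex n) :
    IsPolynomialMap (localEquation k a) := by
  have e := isPolynomialMap_entry (n := n)
  have htr := IsPolynomialMap.sum Finset.univ fun i => e i i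
  rcases a with ⟨i, j⟩ | j | _
  · exact ((e _ _).mul (e _ _)).sub ((e _ _).mul (e _ _))
  · exact (e _ _).sub (e _ _).conjugate
  · exact ((IsPolynomialMap.const _).mul
      ((htr.add htr.conjugate).add ((e k k).sub (e k k).conjugate))).sub (.const 1)

theorem localEquation_eq_zero (a : EquationIndex n) {y : AmbientSpace n}
    (hy : y ∈ Set.range (projectorMap n)) : localEquation k a y = 0 := by
  obtain ⟨hminor, htr, hherm⟩ := (mem_range_projectorMap_iff y).1 hy
  rcases a with ⟨i, j⟩ | j | _
  · have := hminor k k (k.succAbove i) (k.succAbove j)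
    simp only [localEquation]
    linear_combination this
  · exact hherm _ _
  · simp only [localEquation, sub_eq_zero.1 htr, hherm, map_one]
    norm_num

theorem hasDerivAt_localEquation (x v : AmbientSpace n) (a : EquationIndex n) :
    HasDerivAt (fun t : ℝ => localEquation k a (x + t • v)) (localEquationDeriv k x v a) 0 := by
  have he (i j : Fin (n + 1)) :
      HasDerivAt (fun t : ℝ => entry i j (x + t • v)) (entry i j v) 0 := by
    have hline : HasDerivAt (fun t : ℝ => x + t • v) v 0 := by
      simpa using ((hasDerivAt_id (0 : ℝ)).smul_const v).const_add x
    exact (entry i j).hasFDerivAt.comp_hasDerivAt (0 : ℝ) hline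
  have hconj {f : ℝ → ℂ} {f' : ℂ} (hf : HasDerivAt f f' 0) :
      HasDerivAt (fun t => conj (f t)) (conj f') 0 :=
    Complex.conjCLE.toContinuousLinearMap.hasFDerivAt.comp_hasDerivAt (0 : ℝ) hf
  rcases a with ⟨i, j⟩ | j | _
  · simpa [localEquation, localEquationDeriv] using
      ((he k k).fun_mul (he _ _)).fun_sub ((he (k.succAbove i) k).fun_mul (he k (k.succAbove j)))
  · exact (he _ _).sub (hconj (he _ _))
  · have htr := HasDerivAt.fun_sum (u := Finset.univ) fun i _ => he i i
    exact (((htr.add (hconj htr)).add ((he k k).sub (hconj (he k k)))).const_mul (1 / 2)).sub_const 1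

/-- Packs two real equations into one complex equation, so that the real count is `2(n² + n + 1)`,
exactly the codimension. -/
theorem half_mul_eq_re_add_im (z w : ℂ) :
    (1 / 2 : ℂ) * ((z + conj z) + (w - conj w)) = z.re + w.im * Complex.I := by
  rw [Complex.add_conj, Complex.sub_conj]
  push_cast
  ring

/-- The matrix `M` solves the minor and Hermitian parts and the condition on `Im w_kk`: the rest of
its `k`-th column is zero, its `k`-th row is prescribed, and the other entries follow on dividing by
`w_kk`. The real trace is then corrected along `x`, a direction that leaves the other conditions
unchanged. -/
theorem localEquationDeriv_surjective {x : AmbientSpace n} (hk : entry k k x ≠ 0)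
    (hx : x ∈ Set.range (projectorMap n)) : Function.Surjective (localEquationDeriv k x) := by
  intro T
  let s : ℂ := (T (.inr (.inr ()))).im * Complex.I
  let M : Matrix (Fin (n + 1)) (Fin (n + 1)) ℂ := Matrix.of
    (k.insertNth (α := fun _ => Fin (n + 1) → ℂ)
      (k.insertNth (α := fun _ => ℂ) s fun j => T (.inr (.inl j)))
      fun i => k.insertNth (α := fun _ => ℂ) 0 fun j =>
        (T (.inl (i, j)) - s * entry (k.succAbove i) (k.succAbove j) x +
          entry (k.succAbove i) k x * T (.inr (.inl j))) / entry k k x)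
  -- Since `x` has trace `1`, adding `t • x` raises the real trace by exactly `t`.
  let t : ℝ := (T (.inr (.inr ()))).re - (∑ i, M i i).re
  have h₁ : M k k = s := by simp [M]
  have h₂ (j : Fin n) : M k (k.succAbove j) = T (.inr (.inl j)) := by simp [M]
  have h₃ (i : Fin n) : M (k.succAbove i) k = 0 := by simp [M]
  have h₄ (i j : Fin n) : entry k k x * M (k.succAbove i) (k.succAbove j) =
      T (.inl (i, j)) - s * entry (k.succAbove i) (k.succAbove j) x +
        entry (k.succAbove i) k x * T (.inr (.inl j)) := by
    simp [M, mul_div_cancel₀ _ hk]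
  have hv (i j : Fin (n + 1)) :
      entry i j (realCoords n M + t • x) = M i j + t * entry i j x := by simp
  obtain ⟨hminor, htr, hherm⟩ := (mem_range_projectorMap_iff x).1 hx
  refine ⟨realCoords n M + t • x, funext ?_⟩
  rintro (⟨i, j⟩ | j | _)
  · have hm := hminor k k (k.succAbove i) (k.succAbove j)
    simp only [localEquationDeriv, hv, h₁, h₂, h₃]
    -- The minors are quadratic, so by Euler's relation their derivative at `x` along `x` is twice
    -- their value, which is zero.
    linear_combination h₄ i j + 2 * (t : ℂ) * hm
  · simp only [localEquationDeriv, hv, h₂, h₃, map_add, map_mul, map_zero, Complex.conj_ofReal]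
    linear_combination (t : ℂ) * hherm k (k.succAbove j)
  · have hkk : (entry k k x).im = 0 := by
      rw [← Complex.conj_eq_iff_im]
      exact (sub_eq_zero.1 (hherm k k)).symm
    simp only [localEquationDeriv, hv, half_mul_eq_re_add_im, Finset.sum_add_distrib,
      ← Finset.mul_sum, sub_eq_zero.1 htr, h₁]
    apply Complex.ext <;> simp [t, s, hkk]

/-- Hermitian symmetry of the `k`-th row and column and the minors through `(k, k)` determine every
entry by the `k`-th column. It remains to see that the trace, known only in its real part, is real.
-/
theorem mem_range_of_localEquation {y : AmbientSpace n} (hk : entry k k y ≠ 0)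
    (hy : ∀ a, localEquation k a y = 0) : y ∈ Set.range (projectorMap n) := by
  have hre : (∑ i, entry i i y).re = 1 ∧ (entry k k y).im = 0 := by
    have h := hy (.inr (.inr ()))
    simp only [localEquation, half_mul_eq_re_add_im] at h
    have h1 := congrArg Complex.re h
    have h2 := congrArg Complex.im h
    simp only [Complex.sub_re, Complex.sub_im, Complex.add_re, Complex.add_im, Complex.mul_re,
      Complex.mul_im, Complex.ofReal_re, Complex.ofReal_im, Complex.I_re, Complex.I_im,
      Complex.one_re, Complex.one_im, Complex.zero_re, Complex.zero_im] at h1 h2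
    constructor <;> linarith
  have hkk : conj (entry k k y) = entry k k y := Complex.conj_eq_iff_im.2 hre.2
  have hrow (j : Fin (n + 1)) : conj (entry j k y) = entry k j y :=
    Fin.succAboveCases k hkk (fun j => (sub_eq_zero.1 (hy (.inr (.inl j)))).symm) j
  have hcol (i j : Fin (n + 1)) :
      entry i k y * conj (entry j k y) = entry k k y * entry i j y := by
    rw [hrow]
    refine Fin.succAboveCases k rfl (fun i => ?_) i
    refine Fin.succAboveCases k (mul_comm _ _) (fun j => ?_) j
    exact (sub_eq_zero.1 (hy (.inl (i, j)))).symm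
  -- Here `w_kk * w_ii = w_ik * conj (w_ik)` is real, and `w_kk` is real and nonzero.
  have hdiag (i : Fin (n + 1)) : (entry i i y).im = 0 := by
    rw [← Complex.conj_eq_iff_im]
    have h := congrArg conj (hcol i i)
    rw [map_mul, map_mul, Complex.conj_conj, hkk, mul_comm, hcol] at h
    exact (mul_left_cancel₀ hk h).symm
  have htr : ∑ i, entry i i y = 1 := by
    apply Complex.ext
    · exact hre.1
    · simp [Complex.im_sum, hdiag]
  have h := projectorMatrix_column (w := (realCoords n).symm y) hk hcol htr
  exact ⟨_, (congrArg (realCoords n) h).trans ((realCoords n).apply_symm_apply y)⟩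

end LocalEquations

theorem isSmoothRealAlgebraic_range_projectorMap (n : ℕ) :
    IsSmoothRealAlgebraic (2 * n) (Set.range (projectorMap n)) := by
  refine isSmoothRealAlgebraic_of_isPolynomialMap (κ := EquationIndex n)
    (isRealAlgebraic_range_projectorMap n) ?_ fun x hx => ?_
  · simp
    ring
  · obtain ⟨k, hk⟩ : ∃ k, entry k k x ≠ 0 := by
      obtain ⟨y, rfl⟩ := hx
      simpa [projectorMap] using exists_diag_ne_zero (projectorMatrix_mem_rankOneProjectors y)
    exact ⟨localEquation k, localEquationDeriv k x, isPolynomialMap_localEquation k,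
      fun a y hy => localEquation_eq_zero k a hy, hasDerivAt_localEquation k x,
      localEquationDeriv_surjective k hk hx, _, isOpen_diag_ne_zero k, hk,
      fun y hyk hy => mem_range_of_localEquation k hyk hy⟩

theorem mainTheorem7 (n : ℕ) :
    Manifold.IsSmoothEmbedding 𝓘(ℝ, Fin n → ℂ) 𝓘(ℝ, AmbientSpace n) ∞ (projectorMap n) ∧
    Set.range (projectorMap n) = realCoords n '' rankOneProjectors n ∧
    IsSmoothRealAlgebraic (2 * n) (Set.range (projectorMap n)) ∧
    ∀ B : Set (CP n), IsComplexAlgebraic B → IsRealAlgebraic (projectorMap n '' B) :=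
  ⟨isSmoothEmbedding_projectorMap n, range_projectorMap n,
    isSmoothRealAlgebraic_range_projectorMap n, fun _ hB => isRealAlgebraic_image_projectorMap hB⟩
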